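/- A propositional language $\mathcal L$ consists of propositional variables $X_1, X_2, \dots$ and finitely many connectives $\Box_1,\dots,\Box_r$ with arities $n_1,\dots,n_r \ge 0$. A Hilbert-type calculus $\mathbf C$ in $\mathcal L$ is given by a finite set of axioms, which are formulas of $\mathcal L$, and a finite set of rules, each with finitely many formulas of $\mathcal L$ as premises and one formula of $\mathcal L$ as conclusion. A theorem of $\mathbf C$ is the last formula of a finite sequence of formulas, each of which is a substitution instance of an axiom or follows from earlier formulas of the sequence by a substitution instance of a rule. For $m \in \mathbb N$, an $m$-valued logic $\mathbf M$ for $\mathcal L$ is given by $m$ truth values, a subset of designated truth values, and, for each connective of $\mathcal L$, a truth function of the same arity. A tautology of $\mathbf M$ is a formula of $\mathcal L$ that takes a designated value under every assignment of truth values to the variables. $\mathbf C$ is weakly sound for $\mathbf M$ if every theorem of $\mathbf C$ is a tautology of $\mathbf M$. Proposition. It is undecidable whether a calculus $\mathbf C$ is weakly sound for a given $m$-valued logic $\mathbf M$. That is, there is no algorithm that, given a propositional language $\mathcal L$, a Hilbert-type calculus $\mathbf C$ in $\mathcal L$ and a finite-valued logic $\mathbf M$ for $\mathcal L$ (all presented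 as finite words, the truth functions by their truth tables), decides whether $\mathbf C$ is weakly sound for $\mathbf M$. Moreover, for every fixed $m \ge 2$ there is no such algorithm even if the inputs are restricted to $m$-valued logics $\mathbf M$. -/

import Mathlib

namespace PropLogic

/-! ### Languages, formulas, substitutions -/

/-- A propositional language: finitely many connectives, given by the list of their arities.
Connectives of arity `0` are propositional constants.  The propositional variables are
indexed by the natural numbers. -/
structure Language where
  arities : List ℕ

/-- The connectives of a language. -/
abbrev Language.Conn (L : Language) : Type := Fin L.arities.length

/-- The arity of a connective. -/
abbrev Language.arity (L : Language) (j : L.Conn) : ℕ := L.arities.get j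

/-- The formulas of a language. -/
inductive Formula (L : Language) : Type
  | var (i : ℕ) : Formula L
  | app (j : L.Conn) (args : Fin (L.arity j) → Formula L) : Formula L

/-- `F.subst σ` is the result of simultaneously replacing every variable `X` of `F` by `σ X`. -/
def Formula.subst {L : Language} (σ : ℕ → Formula L) : Formula L → Formula L
  | .var i => σ i
  | .app j args => .app j fun k => (args k).subst σ

/-! ### Hilbert-type calculi -/

/-- A rule with a finite list of premises and a conclusion. -/
structure Rule (L : Language) where
  premises : List (Formula L)
  conclusion : Formula L

/-- A propositional Hilbert-type calculus, presented by a finite list of axioms and a finite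
list of rules. -/
structure Calculus (L : Language) where
  axs : List (Formula L)
  rules : List (Rule L)

/-- A derivation: a finite sequence of formulas, each of which is a substitution instance of an
axiom, or follows from earlier members of the sequence by a substitution instance of a rule. -/
def Calculus.IsDerivation {L : Language} (C : Calculus L) (s : List (Formula L)) : Prop :=
  ∀ (i : ℕ) (hi : i < s.length), ∃ σ : ℕ → Formula L,
    (∃ A ∈ C.axs, s[i] = A.subst σ) ∨
    (∃ r ∈ C.rules,
      (∀ A ∈ r.premises, ∃ (k : ℕ) (hk : k < i), s[k] = A.subst σ) ∧
      s[i] = r.conclusion.subst σ)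

/-- The set of theorems of a calculus: the last formulas of its derivations. -/
def Calculus.Thm {L : Language} (C : Calculus L) : Set (Formula L) :=
  {F | ∃ s : List (Formula L), C.IsDerivation s ∧ s.getLast? = some F}

/-! ### Finite-valued logics -/

/-- An `m`-valued logic for the language `L`, with truth values `0, …, m - 1`. -/
structure ValuedLogic (L : Language) (m : ℕ) where
  designated : Finset (Fin m)
  truthFn : (j : L.Conn) → (Fin (L.arity j) → Fin m) → Fin m

/-- The extension of a valuation of the variables to all formulas. -/
def ValuedLogic.eval {L : Language} {m : ℕ} (M : ValuedLogic L m) (v : ℕ → Fin m) :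
    Formula L → Fin m
  | .var i => v i
  | .app j args => M.truthFn j fun k => M.eval v (args k)

/-- The set of tautologies: the formulas that are satisfied by every valuation. -/
def ValuedLogic.Taut {L : Language} {m : ℕ} (M : ValuedLogic L m) : Set (Formula L) :=
  {F | ∀ v : ℕ → Fin m, M.eval v F ∈ M.designated}

/-- `C` is weakly sound for `M` if every theorem of `C` is a tautology of `M`. -/
def WeaklySound {L : Language} {m : ℕ} (C : Calculus L) (M : ValuedLogic L m) : Prop :=
  C.Thm ⊆ M.Taut

/-! ### Inputs of the decision problem, and their presentation as words -/

/-- A language together with a calculus and an `m`-valued logic for this language. -/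
structure Input (m : ℕ) where
  lang : Language
  calculus : Calculus lang
  logic : ValuedLogic lang m

/-- A finite list is written as its length followed by its entries. -/
def codeList {α : Type} (f : α → List ℕ) (l : List α) : List ℕ :=
  l.length :: (l.map f).flatten

/-- Formulas are written in Polish notation; the variable `i` is the symbol `2 * i` and the
connective `j` is the symbol `2 * j + 1`. -/
def Formula.code {L : Language} : Formula L → List ℕ
  | .var i => [2 * i]
  | .app j args => (2 * (j : ℕ) + 1) :: (List.ofFn fun k => (args k).code).flatten

/-- A language is written as the list of the arities of its connectives. -/
def Language.code (L : Language) : List ℕ := codeList (fun n => [n]) L.arities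

/-- A rule is written as the list of its premises followed by its conclusion. -/
def Rule.code {L : Language} (r : Rule L) : List ℕ :=
  codeList Formula.code r.premises ++ r.conclusion.code

/-- A calculus is written as the list of its axioms followed by the list of its rules. -/
def Calculus.code {L : Language} (C : Calculus L) : List ℕ :=
  codeList Formula.code C.axs ++ codeList Rule.code C.rules

/-- The truth table of an `n`-ary truth function: its values at the `m ^ n` tuples, in the
order of `finFunctionFinEquiv`. -/
def tableCode {n m : ℕ} (f : (Fin n → Fin m) → Fin m) : List ℕ :=
  List.ofFn fun k : Fin (m ^ n) => (f (finFunctionFinEquiv.symm k) : ℕ)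

/-- An `m`-valued logic is written as the `0`-`1` sequence that tells which truth values are
designated, followed by the truth tables of the connectives. -/
def ValuedLogic.code {L : Language} {m : ℕ} (M : ValuedLogic L m) : List ℕ :=
  (List.ofFn fun v : Fin m => if v ∈ M.designated then 1 else 0) ++
    (List.ofFn fun j : L.Conn => tableCode (M.truthFn j)).flatten

/-- The word that presents an input: the number of truth values, the language, the calculus and
the logic. -/
def Input.code {m : ℕ} (I : Input m) : List ℕ :=
  m :: (I.lang.code ++ (I.calculus.code ++ I.logic.code))

/-- A property `p` of the objects of a type `ι`, each of which is presented to algorithms as the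
word `code i`, is decidable if there is an algorithm (a partial recursive function) that halts
on the code of every object `i` and outputs `true` or `false` there according to whether `p i`
holds.  Nothing is demanded on words that are not codes. -/
def AlgDecidable {ι : Type} (code : ι → List ℕ) (p : ι → Prop) : Prop :=
  ∃ f : List ℕ →. Bool, Partrec f ∧ ∀ i : ι, ∃ b : Bool, b ∈ f (code i) ∧ (b = true ↔ p i)

/-! ### Sanity check: inputs can be read off from their codes -/

/-- Unique readability, also when further symbols follow. -/
def PrefixInj {α : Type} (f : α → List ℕ) : Prop :=
  ∀ a b s t, f a ++ s = f b ++ t → a = b ∧ s = t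

theorem prefixInj_ofFn {α : Type} {f : α → List ℕ} {n : ℕ} (a b : Fin n → α)
    (h : ∀ k y s t, f (a k) ++ s = f y ++ t → a k = y ∧ s = t) (s t : List ℕ)
    (e : (List.ofFn fun k => f (a k)).flatten ++ s = (List.ofFn fun k => f (b k)).flatten ++ t) :
    a = b ∧ s = t := by
  induction n with
  | zero => exact ⟨Subsingleton.elim _ _, by simpa using e⟩
  | succ n ih =>
    simp only [List.ofFn_succ, List.flatten_cons, List.append_assoc] at e
    obtain ⟨h0, e⟩ := h 0 _ _ _ e
    obtain ⟨h1, e⟩ := ih (fun k => a k.succ) (fun k => b k.succ) (fun k => h k.succ) e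
    refine ⟨funext fun k => ?_, e⟩
    induction k using Fin.cases with
    | zero => exact h0
    | succ k => exact congrFun h1 k

theorem prefixInj_codeList {α : Type} {f : α → List ℕ} (h : PrefixInj f) :
    PrefixInj (codeList f) := by
  intro a
  induction a with
  | nil =>
    rintro (_ | ⟨y, b⟩) s t e
    · simpa [codeList] using e
    · simp [codeList] at e
  | cons x a ih =>
    rintro (_ | ⟨y, b⟩) s t e
    · simp [codeList] at e
    · simp only [codeList, List.length_cons, List.map_cons, List.flatten_cons, List.cons_append,
        List.append_assoc, List.cons.injEq, Nat.add_right_cancel_iff] at e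
      obtain ⟨e0, e2⟩ := e
      obtain ⟨rfl, e3⟩ := h _ _ _ _ e2
      obtain ⟨rfl, e4⟩ := ih b s t (by simp [codeList, e0, e3])
      exact ⟨rfl, e4⟩

theorem Formula.prefixInj_code {L : Language} : PrefixInj (Formula.code (L := L)) := by
  intro a
  induction a with
  | var i =>
    rintro (i' | ⟨j, args⟩) s t e
    · simp only [Formula.code, List.cons_append, List.nil_append, List.cons.injEq] at e
      exact ⟨by rw [show i = i' by omega], e.2⟩
    · simp only [Formula.code, List.cons_append, List.nil_append, List.cons.injEq] at e
      omega
  | app j args ih =>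
    rintro (i' | ⟨j', args'⟩) s t e
    · simp only [Formula.code, List.cons_append, List.nil_append, List.cons.injEq] at e
      omega
    · simp only [Formula.code, List.cons_append, List.cons.injEq] at e
      obtain ⟨e0, e2⟩ := e
      obtain rfl : j = j' := Fin.ext (by omega)
      obtain ⟨rfl, e3⟩ := prefixInj_ofFn args args' (fun k y s t => ih k y s t) s t e2
      exact ⟨rfl, e3⟩

theorem Rule.prefixInj_code {L : Language} : PrefixInj (Rule.code (L := L)) := by
  rintro ⟨p, c⟩ ⟨p', c'⟩ s t e
  simp only [Rule.code, List.append_assoc] at e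
  obtain ⟨rfl, e2⟩ := prefixInj_codeList Formula.prefixInj_code _ _ _ _ e
  obtain ⟨rfl, e3⟩ := Formula.prefixInj_code _ _ _ _ e2
  exact ⟨rfl, e3⟩

theorem Calculus.prefixInj_code {L : Language} : PrefixInj (Calculus.code (L := L)) := by
  rintro ⟨p, c⟩ ⟨p', c'⟩ s t e
  simp only [Calculus.code, List.append_assoc] at e
  obtain ⟨rfl, e2⟩ := prefixInj_codeList Formula.prefixInj_code _ _ _ _ e
  obtain ⟨rfl, e3⟩ := prefixInj_codeList Rule.prefixInj_code _ _ _ _ e2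
  exact ⟨rfl, e3⟩

theorem Language.prefixInj_code : PrefixInj Language.code := by
  rintro ⟨a⟩ ⟨b⟩ s t e
  obtain ⟨rfl, e2⟩ := prefixInj_codeList (f := fun n => [n]) (by intro a b s t e; simpa using e)
    _ _ _ _ e
  exact ⟨rfl, e2⟩

theorem prefixInj_tableCode {n m : ℕ} : PrefixInj (tableCode (n := n) (m := m)) := by
  intro f g s t e
  obtain ⟨h, e2⟩ := List.append_inj e (by simp [tableCode])
  refine ⟨funext fun x => ?_, e2⟩
  have := congrFun (List.ofFn_injective h) (finFunctionFinEquiv x)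
  exact Fin.ext (by simpa using this)

theorem ValuedLogic.code_injective {L : Language} {m : ℕ} :
    Function.Injective (ValuedLogic.code (L := L) (m := m)) := by
  rintro ⟨D, f⟩ ⟨D', f'⟩ e
  obtain ⟨h, e2⟩ := List.append_inj e (by simp)
  have hD : D = D' := by
    ext v
    have := congrFun (List.ofFn_injective h) v
    by_cases h1 : v ∈ D <;> by_cases h2 : v ∈ D' <;> simp_all
  have hf : ∀ (l : List ℕ) (f f' : (j : Fin l.length) → (Fin (l.get j) → Fin m) → Fin m),
      (List.ofFn fun j => tableCode (f j)).flatten = (List.ofFn fun j => tableCode (f' j)).flatten →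
      f = f' := by
    intro l
    induction l with
    | nil => intro f f' _; exact funext fun j => j.elim0
    | cons n l ih =>
      intro f f' e2
      simp only [List.length_cons, List.ofFn_succ, List.flatten_cons] at e2
      obtain ⟨h0, e3⟩ := prefixInj_tableCode _ _ _ _ e2
      have h1 := ih (fun j => f j.succ) (fun j => f' j.succ) e3
      funext j
      induction j using Fin.cases with
      | zero => exact h0
      | succ j => exact congrFun h1 j
  obtain rfl := hD
  obtain rfl := hf _ _ _ e2
  rfl

/-- Different inputs have different codes. -/
theorem Input.code_injective :
    Function.Injective (fun I : Σ m : ℕ, Input m => I.2.code) := by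
  rintro ⟨m, L, C, M⟩ ⟨m', L', C', M'⟩ e
  simp only [Input.code, List.cons.injEq] at e
  obtain ⟨rfl, e2⟩ := e
  obtain ⟨rfl, e3⟩ := Language.prefixInj_code _ _ _ _ e2
  obtain ⟨rfl, e4⟩ := Calculus.prefixInj_code _ _ _ _ e3
  obtain rfl := ValuedLogic.code_injective e4
  rfl

end PropLogic

/-!
The halting problem is reduced to weak soundness.  In Mathlib's model of computation
`Turing.ToPartrec.Code`, programs map lists of natural numbers to lists of natural numbers, and
their evaluation is described by finitely many Horn clauses about the judgement "the program `c`
maps the list `v` to the list `w`".  Over a propositional language whose connectives build numbers,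
lists, programs and judgements, Horn clauses are nothing but axioms and rules, and matching a
clause is substitution.  One further rule derives a constant `bot` from the judgement that the
program `c` has some value at `[n]`.

All true judgements are derivable, by induction on the program (`evalLang.ev_mem_thm`), so `bot` is
a theorem if `c` halts on `[n]` (`evalLang.bot_mem_thm`).  Conversely, the axioms and rules hold in
a structure in which judgements have their intended meaning and `bot` means that `c` halts on `[n]`
(`evalLang.holds_of_mem_thm`).  In this structure variables may be false, so that no variable is a
theorem, and `bot` is one only if `c` halts on `[n]`.

In the logic in which `bot` has the undesignated value `0` and every other connective is constantly
`1`, with `1` designated, each formula other than `bot` and the variables is a tautology.  Hence the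
calculus is weakly sound if and only if `c` does not halt on `[n]` (`evalLang.weaklySound_iff`).
Programs, language and logic being fixed, `n` enters the presentation of the instance as a single
unary numeral, so the presentation is computable from `n` (`evalLang.computable_code_input`), and
for a universal program `c` (`evalLang.exists_universal`) a decision algorithm would solve the
halting problem.
-/

namespace PropLogic

open Turing (ToPartrec.Code)
open Turing.ToPartrec

/-! ### Derivability in a calculus -/

theorem Calculus.IsDerivation.append {L : Language} {C : Calculus L} {s t : List (Formula L)}
    (hs : C.IsDerivation s) (ht : C.IsDerivation t) : C.IsDerivation (s ++ t) := by
  intro i hi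
  by_cases his : i < s.length
  · obtain ⟨σ, h | ⟨r, hr, hp, hc⟩⟩ := hs i his
    · exact ⟨σ, .inl (by simpa [List.getElem_append_left his] using h)⟩
    · refine ⟨σ, .inr ⟨r, hr, fun A hA => ?_, by simpa [List.getElem_append_left his] using hc⟩⟩
      obtain ⟨k, hk, e⟩ := hp A hA
      exact ⟨k, hk, by rw [List.getElem_append_left (hk.trans his), e]⟩
  · have hlt : i - s.length < t.length := by simp only [List.length_append] at hi; omega
    obtain ⟨σ, h | ⟨r, hr, hp, hc⟩⟩ := ht _ hlt
    · exact ⟨σ, .inl (by simpa [List.getElem_append_right (not_lt.1 his)] using h)⟩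
    · refine ⟨σ, .inr ⟨r, hr, fun A hA => ?_,
        by simpa [List.getElem_append_right (not_lt.1 his)] using hc⟩⟩
      obtain ⟨k, hk, e⟩ := hp A hA
      refine ⟨s.length + k, by omega, ?_⟩
      rw [List.getElem_append_right (by omega)]
      simpa using e

/-- Finitely many theorems occur together in one derivation. -/
theorem Calculus.exists_derivation_forall_mem {L : Language} {C : Calculus L} :
    ∀ l : List (Formula L), (∀ F ∈ l, F ∈ C.Thm) → ∃ s, C.IsDerivation s ∧ ∀ F ∈ l, F ∈ s
  | [], _ => ⟨[], fun i hi => absurd hi (Nat.not_lt_zero i), by simp⟩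
  | F :: l, h => by
    obtain ⟨s, hs, hsF⟩ := h F (by simp)
    obtain ⟨t, ht, htl⟩ := exists_derivation_forall_mem l fun G hG => h G (by simp [hG])
    refine ⟨s ++ t, hs.append ht, fun G hG => ?_⟩
    rcases List.mem_cons.1 hG with rfl | hG
    · exact List.mem_append_left _ (List.mem_of_getLast? hsF)
    · exact List.mem_append_right _ (htl G hG)

theorem Calculus.thm_of_ax {L : Language} {C : Calculus L} {A : Formula L} (hA : A ∈ C.axs)
    (σ : ℕ → Formula L) : A.subst σ ∈ C.Thm := by
  refine ⟨[A.subst σ], fun i hi => ⟨σ, .inl ⟨A, hA, ?_⟩⟩, rfl⟩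
  obtain rfl : i = 0 := by simpa using hi
  rfl

theorem Calculus.thm_of_rule {L : Language} {C : Calculus L} {r : Rule L} (hr : r ∈ C.rules)
    (σ : ℕ → Formula L) (h : ∀ A ∈ r.premises, A.subst σ ∈ C.Thm) :
    r.conclusion.subst σ ∈ C.Thm := by
  obtain ⟨s, hs, hmem⟩ := C.exists_derivation_forall_mem (r.premises.map (Formula.subst σ))
    (by simpa using h)
  refine ⟨s ++ [r.conclusion.subst σ], fun i hi => ?_, by simp⟩
  by_cases his : i < s.length
  · obtain ⟨τ, h | ⟨r', hr', hp, hc⟩⟩ := hs i his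
    · exact ⟨τ, .inl (by simpa [List.getElem_append_left his] using h)⟩
    · refine ⟨τ, .inr ⟨r', hr', fun A hA => ?_, by simpa [List.getElem_append_left his] using hc⟩⟩
      obtain ⟨k, hk, e⟩ := hp A hA
      exact ⟨k, hk, by rw [List.getElem_append_left (hk.trans his), e]⟩
  · obtain rfl : i = s.length := by simp at hi; omega
    refine ⟨σ, .inr ⟨r, hr, fun A hA => ?_, by simp⟩⟩
    obtain ⟨k, hk, e⟩ := List.getElem_of_mem (hmem _ (List.mem_map_of_mem hA))
    exact ⟨k, hk, by rw [List.getElem_append_left hk, e]⟩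

/-- A property of formulas that holds of the instances of the axioms and is preserved by the
instances of the rules holds of all theorems. -/
theorem Calculus.thm_induction {L : Language} {C : Calculus L} {P : Formula L → Prop}
    (hax : ∀ A ∈ C.axs, ∀ σ, P (A.subst σ))
    (hrule : ∀ r ∈ C.rules, ∀ σ, (∀ A ∈ r.premises, P (A.subst σ)) → P (r.conclusion.subst σ))
    {F : Formula L} (hF : F ∈ C.Thm) : P F := by
  obtain ⟨s, hs, hlast⟩ := hF
  have key : ∀ i (hi : i < s.length), P s[i] := by
    intro i
    induction i using Nat.strong_induction_on with
    | _ i ih =>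
      intro hi
      obtain ⟨σ, ⟨A, hA, e⟩ | ⟨r, hr, hp, e⟩⟩ := hs i hi
      · exact e ▸ hax A hA σ
      · refine e ▸ hrule r hr σ fun A hA => ?_
        obtain ⟨k, hk, e'⟩ := hp A hA
        exact e' ▸ ih k hk (hk.trans hi)
  obtain ⟨k, hk, e⟩ := List.getElem_of_mem (List.mem_of_getLast? hlast)
  exact e ▸ key k hk


/-! ### Formulas with argument lists -/

/-- The application of a connective to a list of arguments. -/
def Formula.mk {L : Language} (j : L.Conn) (l : List (Formula L))
    (h : l.length = L.arity j := by rfl) : Formula L :=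
  .app j fun k => l[(k : ℕ)]'(k.isLt.trans_eq h.symm)

theorem Formula.subst_mk {L : Language} (σ : ℕ → Formula L) (j : L.Conn) (l : List (Formula L))
    (h : l.length = L.arity j) :
    (Formula.mk j l h).subst σ = .mk j (l.map (Formula.subst σ)) (by simpa using h) := by
  simp [Formula.mk, Formula.subst]

theorem Formula.code_mk {L : Language} (j : L.Conn) (l : List (Formula L))
    (h : l.length = L.arity j) :
    (Formula.mk j l h).code = (2 * (j : ℕ) + 1) :: (l.map Formula.code).flatten := by
  simp only [Formula.mk, Formula.code]
  congr 2
  exact List.ext_getElem (by simp [h]) (by simp)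

/-- The interpretation of a formula in a structure with carrier `V`, under the assignment `e`.
The structure assigns values to the pairs of a connective and a list of arguments; only lists
whose length is the arity matter. -/
def Formula.interp {L : Language} {V : Type} (I : L.Conn → List V → V) (e : ℕ → V) :
    Formula L → V
  | .var i => e i
  | .app j args => I j (List.ofFn fun k => (args k).interp I e)

theorem Formula.interp_mk {L : Language} {V : Type} (I : L.Conn → List V → V) (e : ℕ → V)
    (j : L.Conn) (l : List (Formula L)) (h : l.length = L.arity j) :
    (Formula.mk j l h).interp I e = I j (l.map fun F => F.interp I e) := by
  simp only [Formula.mk, Formula.interp]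
  congr 1
  exact List.ext_getElem (by simp [h]) (by simp)

theorem Formula.interp_subst {L : Language} {V : Type} (I : L.Conn → List V → V) (e : ℕ → V)
    (σ : ℕ → Formula L) (F : Formula L) :
    (F.subst σ).interp I e = F.interp I fun i => (σ i).interp I e := by
  induction F with
  | var i => rfl
  | app j args ih => simp only [Formula.subst, Formula.interp, ih]

/-! ### The calculus of evaluation judgements -/

/-- The language in which the evaluation of programs is described.  In the order of their indices
the connectives stand for: falsity, the judgement that a program maps a list to a list, zero and
successor of numbers, the empty list and the adjunction of a head to a list, and the seven
constructors of `Turing.ToPartrec.Code`. -/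
abbrev evalLang : Language := ⟨[0, 3, 0, 1, 0, 2, 0, 0, 0, 2, 2, 2, 1]⟩

namespace evalLang

/-- The constant for falsity. -/
abbrev bot : Formula evalLang := .mk (0 : Fin 13) []

/-- The judgement that the program `c` maps the list `v` to the list `w`. -/
abbrev ev (c v w : Formula evalLang) : Formula evalLang := .mk (1 : Fin 13) [c, v, w]

/-- The number zero. -/
abbrev zero : Formula evalLang := .mk (2 : Fin 13) []

/-- The successor of a number. -/
abbrev succ (n : Formula evalLang) : Formula evalLang := .mk (3 : Fin 13) [n]

/-- The empty list. -/
abbrev nil : Formula evalLang := .mk (4 : Fin 13) []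

/-- The list with head `n` and tail `v`. -/
abbrev cons (n v : Formula evalLang) : Formula evalLang := .mk (5 : Fin 13) [n, v]

/-- The program `zero'`. -/
abbrev pZero : Formula evalLang := .mk (6 : Fin 13) []

/-- The program `succ`. -/
abbrev pSucc : Formula evalLang := .mk (7 : Fin 13) []

/-- The program `tail`. -/
abbrev pTail : Formula evalLang := .mk (8 : Fin 13) []

/-- The program constructor `cons`. -/
abbrev pCons (f g : Formula evalLang) : Formula evalLang := .mk (9 : Fin 13) [f, g]

/-- The program constructor `comp`. -/
abbrev pComp (f g : Formula evalLang) : Formula evalLang := .mk (10 : Fin 13) [f, g]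

/-- The program constructor `case`. -/
abbrev pCase (f g : Formula evalLang) : Formula evalLang := .mk (11 : Fin 13) [f, g]

/-- The program constructor `fix`. -/
abbrev pFix (f : Formula evalLang) : Formula evalLang := .mk (12 : Fin 13) [f]

/-- The numeral of a natural number. -/
def num : ℕ → Formula evalLang
  | 0 => zero
  | n + 1 => succ (num n)

/-- The closed formula that denotes a list of natural numbers. -/
def list : List ℕ → Formula evalLang
  | [] => nil
  | n :: v => cons (num n) (list v)

/-- The closed formula that denotes a program. -/
def prog : Code → Formula evalLang
  | .zero' => pZero
  | .succ => pSucc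
  | .tail => pTail
  | .cons f g => pCons (prog f) (prog g)
  | .comp f g => pComp (prog f) (prog g)
  | .case f g => pCase (prog f) (prog g)
  | .fix f => pFix (prog f)

theorem subst_num (σ : ℕ → Formula evalLang) (n : ℕ) : (num n).subst σ = num n := by
  induction n with
  | zero => simp [num, Formula.subst_mk]
  | succ n ih => simp [num, Formula.subst_mk, ih]

theorem subst_prog (σ : ℕ → Formula evalLang) (c : Code) : (prog c).subst σ = prog c := by
  induction c <;> simp_all [prog, Formula.subst_mk]

theorem code_num (n : ℕ) : (num n).code = List.replicate n 7 ++ [5] := by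
  induction n with
  | zero => simp [num, Formula.code_mk]
  | succ n ih => simp [num, Formula.code_mk, ih, List.replicate_succ]

/-- The judgements that hold outright, for the programs `zero'`, `succ` and `tail`.  As the head
and the tail of the empty list count as `0` and `[]`, the empty list is a separate case. -/
def axs : List (Formula evalLang) :=
  let x := Formula.var 0
  let n := Formula.var 1
  [ev pZero x (cons zero x),
    ev pSucc nil (cons (succ zero) nil),
    ev pSucc (cons n x) (cons (succ n) nil),
    ev pTail nil nil,
    ev pTail (cons n x) x]

/-- The recursion clauses for evaluation of the programs built with `cons`, `comp`, `case` and
`fix`, again with separate clauses for the empty list. -/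
def rules : List (Rule evalLang) :=
  let f := Formula.var 0
  let g := Formula.var 1
  let x := Formula.var 2
  let y := Formula.var 3
  let z := Formula.var 4
  let n := Formula.var 5
  [⟨[ev f x (cons n y), ev g x z], ev (pCons f g) x (cons n z)⟩,
    ⟨[ev f x nil, ev g x z], ev (pCons f g) x (cons zero z)⟩,
    ⟨[ev g x y, ev f y z], ev (pComp f g) x z⟩,
    ⟨[ev f nil y], ev (pCase f g) nil y⟩,
    ⟨[ev f x y], ev (pCase f g) (cons zero x) y⟩,
    ⟨[ev g (cons n x) y], ev (pCase f g) (cons (succ n) x) y⟩,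
    ⟨[ev f x (cons zero y)], ev (pFix f) x y⟩,
    ⟨[ev f x nil], ev (pFix f) x nil⟩,
    ⟨[ev f x (cons (succ n) y), ev (pFix f) y z], ev (pFix f) x z⟩]

/-- The rule that derives falsity from the fact that the program `c` has a value at `[n]`. -/
def haltRule (c : Code) (n : ℕ) : Rule evalLang :=
  ⟨[ev (prog c) (cons (num n) nil) (.var 0)], bot⟩

/-- The calculus that derives falsity if and only if the program `c` halts on the input `[n]`. -/
def calculus (c : Code) (n : ℕ) : Calculus evalLang := ⟨axs, haltRule c n :: rules⟩

/-! ### Derivability of correct judgements -/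

/-- In the instance of the axiom, the variables are replaced by the entries of `l`. -/
theorem mem_thm_of_mem_axs {c : Code} {n : ℕ} {A F : Formula evalLang} (hA : A ∈ axs)
    (l : List (Formula evalLang)) (hF : A.subst (fun i => l.getD i bot) = F) :
    F ∈ (calculus c n).Thm :=
  hF ▸ Calculus.thm_of_ax (C := calculus c n) hA _

/-- In the instance of the rule, the variables are replaced by the entries of `l`. -/
theorem mem_thm_of_mem_rules {c : Code} {n : ℕ} {r : Rule evalLang} {F : Formula evalLang}
    (hr : r ∈ rules) (l : List (Formula evalLang))
    (hF : r.conclusion.subst (fun i => l.getD i bot) = F)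
    (hp : ∀ A ∈ r.premises, A.subst (fun i => l.getD i bot) ∈ (calculus c n).Thm) :
    F ∈ (calculus c n).Thm :=
  hF ▸ Calculus.thm_of_rule (C := calculus c n) (List.mem_cons_of_mem _ hr) _ hp

/-- All true evaluation judgements are derivable. -/
theorem ev_mem_thm (c₀ : Code) (n₀ : ℕ) (c : Code) : ∀ v w : List ℕ, w ∈ c.eval v →
    ev (prog c) (list v) (list w) ∈ (calculus c₀ n₀).Thm := by
  induction c with
  | zero' =>
    intro v w h
    obtain rfl : w = 0 :: v := by simpa using h
    refine mem_thm_of_mem_axs (A := axs[0]) (by simp [axs]) [list v] ?_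
    simp [axs, Formula.subst_mk, Formula.subst, prog, list, num]
  | succ =>
    intro v w h
    obtain rfl : w = [v.headI.succ] := by simpa using h
    cases v with
    | nil =>
      refine mem_thm_of_mem_axs (A := axs[1]) (by simp [axs]) [] ?_
      simp [axs, Formula.subst_mk, prog, list, num]
    | cons a v =>
      refine mem_thm_of_mem_axs (A := axs[2]) (by simp [axs]) [list v, num a] ?_
      simp [axs, Formula.subst_mk, Formula.subst, prog, list, num]
  | tail =>
    intro v w h
    obtain rfl : w = v.tail := by simpa using h
    cases v with
    | nil =>
      refine mem_thm_of_mem_axs (A := axs[3]) (by simp [axs]) [] ?_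
      simp [axs, Formula.subst_mk, prog, list]
    | cons a v =>
      refine mem_thm_of_mem_axs (A := axs[4]) (by simp [axs]) [list v, num a] ?_
      simp [axs, Formula.subst_mk, Formula.subst, prog, list]
  | cons f g ihf ihg =>
    intro v w h
    simp only [Code.cons_eval, Part.bind_eq_bind, Part.mem_bind_iff, Part.pure_eq_some,
      Part.mem_some_iff] at h
    obtain ⟨u, hu, z, hz, rfl⟩ := h
    have h1 := ihf _ _ hu
    have h2 := ihg _ _ hz
    cases u with
    | nil =>
      refine mem_thm_of_mem_rules (r := rules[1]) (by simp [rules])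
        [prog f, prog g, list v, nil, list z] ?_ ?_
      all_goals simp_all [rules, Formula.subst_mk, Formula.subst, prog, list, num]
    | cons a u =>
      refine mem_thm_of_mem_rules (r := rules[0]) (by simp [rules])
        [prog f, prog g, list v, list u, list z, num a] ?_ ?_
      all_goals simp_all [rules, Formula.subst_mk, Formula.subst, prog, list]
  | comp f g ihf ihg =>
    intro v w h
    rw [Code.comp_eval] at h
    obtain ⟨u, hu, hw⟩ := Part.mem_bind_iff.1 h
    have h1 := ihg _ _ hu
    have h2 := ihf _ _ hw
    refine mem_thm_of_mem_rules (r := rules[2]) (by simp [rules])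
      [prog f, prog g, list v, list u, list w] ?_ ?_
    all_goals simp_all [rules, Formula.subst_mk, Formula.subst, prog]
  | case f g ihf ihg =>
    intro v w h
    simp only [Code.case_eval] at h
    rcases v with _ | ⟨_ | a, v⟩
    · have h1 := ihf _ _ h
      refine mem_thm_of_mem_rules (r := rules[3]) (by simp [rules])
        [prog f, prog g, nil, list w] ?_ ?_
      all_goals simp_all [rules, Formula.subst_mk, Formula.subst, prog, list]
    · have h1 := ihf _ _ h
      refine mem_thm_of_mem_rules (r := rules[4]) (by simp [rules])
        [prog f, prog g, list v, list w] ?_ ?_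
      all_goals simp_all [rules, Formula.subst_mk, Formula.subst, prog, list, num]
    · have h1 := ihg _ _ h
      refine mem_thm_of_mem_rules (r := rules[5]) (by simp [rules])
        [prog f, prog g, list v, list w, nil, num a] ?_ ?_
      all_goals simp_all [rules, Formula.subst_mk, Formula.subst, prog, list, num]
  | fix f ihf =>
    intro v w h
    rw [Code.fix_eval] at h
    refine PFun.fixInduction' (C := fun v => ev (prog f.fix) (list v) (list w) ∈ _) h ?_ ?_
    · intro v hv
      obtain ⟨u, hu, e⟩ := (Part.mem_map_iff _).1 hv
      have h1 := ihf _ _ hu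
      rcases u with _ | ⟨_ | a, u⟩
      · obtain rfl : [] = w := by simpa using e
        refine mem_thm_of_mem_rules (r := rules[7]) (by simp [rules])
          [prog f, nil, list v] ?_ ?_
        all_goals simp_all [rules, Formula.subst_mk, Formula.subst, prog, list]
      · obtain rfl : u = w := by simpa using e
        refine mem_thm_of_mem_rules (r := rules[6]) (by simp [rules])
          [prog f, nil, list v, list u] ?_ ?_
        all_goals simp_all [rules, Formula.subst_mk, Formula.subst, prog, list, num]
      · simp at e
    · intro v v' _ hv ih
      obtain ⟨u, hu, e⟩ := (Part.mem_map_iff _).1 hv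
      have h1 := ihf _ _ hu
      rcases u with _ | ⟨_ | a, u⟩
      · simp at e
      · simp at e
      · obtain rfl : u = v' := by simpa using e
        refine mem_thm_of_mem_rules (r := rules[8]) (by simp [rules])
          [prog f, nil, list v, list u, list w, num a] ?_ ?_
        all_goals simp_all [rules, Formula.subst_mk, Formula.subst, prog, list, num]

theorem bot_mem_thm {c : Code} {n : ℕ} (h : (c.eval [n]).Dom) : bot ∈ (calculus c n).Thm := by
  obtain ⟨w, hw⟩ := Part.dom_iff_mem.1 h
  have := Calculus.thm_of_rule (C := calculus c n) (r := haltRule c n) (by simp [calculus])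
    (fun _ => list w)
    (by simpa [haltRule, Formula.subst_mk, Formula.subst, subst_prog, subst_num, list]
      using ev_mem_thm c n c _ _ hw)
  simpa [haltRule, Formula.subst_mk] using this

/-! ### Correctness of derivable judgements -/

/-- What a formula of the evaluation language means.  The language has no sorts, so every formula
denotes a number, a list, a program and a proposition at once; a connective determines one of the
four components, and the others receive default values. -/
structure Meaning where
  num : ℕ := 0
  list : List ℕ := []
  prog : Code := .zero'
  holds : Prop := True

/-- The intended structure for the evaluation language, with the proposition `p` as the meaning of
falsity. -/
def meaning (p : Prop) : evalLang.Conn → List Meaning → Meaning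
  | 0, [] => { holds := p }
  | 1, [c, v, w] => { holds := w.list ∈ c.prog.eval v.list }
  | 2, [] => { num := 0 }
  | 3, [n] => { num := n.num + 1 }
  | 4, [] => { list := [] }
  | 5, [n, v] => { list := n.num :: v.list }
  | 6, [] => { prog := .zero' }
  | 7, [] => { prog := .succ }
  | 8, [] => { prog := .tail }
  | 9, [f, g] => { prog := .cons f.prog g.prog }
  | 10, [f, g] => { prog := .comp f.prog g.prog }
  | 11, [f, g] => { prog := .case f.prog g.prog }
  | 12, [f] => { prog := .fix f.prog }
  | _, _ => {}

theorem interp_num (p : Prop) (e : ℕ → Meaning) (n : ℕ) :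
    ((num n).interp (meaning p) e).num = n := by
  induction n with
  | zero => simp [num, Formula.interp_mk, meaning]
  | succ n ih => simp [num, Formula.interp_mk, meaning, ih]

theorem interp_prog (p : Prop) (e : ℕ → Meaning) (c : Code) :
    ((prog c).interp (meaning p) e).prog = c := by
  induction c <;> simp_all [prog, Formula.interp_mk, meaning]

theorem holds_of_mem_axs {A : Formula evalLang} (hA : A ∈ axs) (p : Prop) (e : ℕ → Meaning) :
    (A.interp (meaning p) e).holds := by
  simp only [axs, List.mem_cons, List.not_mem_nil, or_false] at hA
  rcases hA with rfl | rfl | rfl | rfl | rfl <;>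
    simp [Formula.interp_mk, Formula.interp, meaning]

/-- One unfolding of the loop performed by `fix f`. -/
theorem mem_fix_eval_iff {f : Code} {v w : List ℕ} :
    w ∈ (Code.fix f).eval v ↔ ∃ u ∈ f.eval v,
      (u.headI = 0 ∧ w = u.tail) ∨ (u.headI ≠ 0 ∧ w ∈ (Code.fix f).eval u.tail) := by
  rw [Code.fix_eval]
  refine PFun.mem_fix_iff.trans ⟨?_, ?_⟩
  · rintro (h | ⟨v', h', h⟩)
    · obtain ⟨u, hu, e⟩ := (Part.mem_map_iff _).1 h
      refine ⟨u, hu, ?_⟩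
      split_ifs at e with h0
      exact .inl ⟨h0, (Sum.inl.inj e).symm⟩
    · obtain ⟨u, hu, e⟩ := (Part.mem_map_iff _).1 h'
      refine ⟨u, hu, ?_⟩
      split_ifs at e with h0
      exact .inr ⟨h0, Sum.inr.inj e ▸ h⟩
  · rintro ⟨u, hu, ⟨h0, rfl⟩ | ⟨h0, h⟩⟩
    · exact .inl ((Part.mem_map_iff _).2 ⟨u, hu, if_pos h0⟩)
    · exact .inr ⟨_, (Part.mem_map_iff _).2 ⟨u, hu, if_neg h0⟩, h⟩

theorem holds_of_mem_rules {r : Rule evalLang} (hr : r ∈ rules) (p : Prop) (e : ℕ → Meaning)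
    (h : ∀ A ∈ r.premises, (A.interp (meaning p) e).holds) :
    (r.conclusion.interp (meaning p) e).holds := by
  simp only [rules, List.mem_cons, List.not_mem_nil, or_false] at hr
  rcases hr with rfl | rfl | rfl | rfl | rfl | rfl | rfl | rfl | rfl <;>
    simp [Formula.interp_mk, Formula.interp, meaning] at h ⊢
  · exact ⟨_, h.1, h.2, rfl⟩
  · exact ⟨_, h.1, h.2, rfl⟩
  · exact Part.mem_bind_iff.2 ⟨_, h.1, h.2⟩
  · exact h
  · exact h
  · exact h
  · exact mem_fix_eval_iff.2 ⟨_, h, by simp⟩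
  · exact mem_fix_eval_iff.2 ⟨_, h, by simp⟩
  · exact mem_fix_eval_iff.2 ⟨_, h.1, by simpa using h.2⟩

/-- If falsity is taken to mean that the program `c` halts on `[n]`, all theorems hold. -/
theorem holds_of_mem_thm {c : Code} {n : ℕ} {F : Formula evalLang} (hF : F ∈ (calculus c n).Thm)
    (e : ℕ → Meaning) : (F.interp (meaning (c.eval [n]).Dom) e).holds := by
  refine Calculus.thm_induction
    (P := fun F => ∀ e, (F.interp (meaning (c.eval [n]).Dom) e).holds)
    (fun A hA σ e => ?_) (fun r hr σ h e => ?_) hF e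
  · rw [Formula.interp_subst]
    exact holds_of_mem_axs hA _ _
  · rw [Formula.interp_subst]
    rcases List.mem_cons.1 hr with rfl | hr
    · have h := h _ (List.mem_singleton_self _) e
      simp only [subst_prog, subst_num, Formula.subst_mk, List.map_cons, List.map_nil,
        Formula.interp_mk, meaning, interp_prog, interp_num] at h
      simpa [haltRule, Formula.interp_mk, meaning] using Part.dom_iff_mem.2 ⟨_, h⟩
    · exact holds_of_mem_rules hr _ _ fun A hA => by
        simpa only [Formula.interp_subst] using h A hA e

/-! ### The logic and the reduction -/

/-- The `m`-valued logic in which `1` is the only designated value, falsity has the value `0` and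
all other connectives have the constant value `1`. -/
def logic (m : ℕ) (hm : 2 ≤ m) : ValuedLogic evalLang m where
  designated := {⟨1, hm⟩}
  truthFn j _ := if j = (0 : Fin 13) then ⟨0, by omega⟩ else ⟨1, hm⟩

theorem weaklySound_iff (c : Code) (n m : ℕ) (hm : 2 ≤ m) :
    WeaklySound (calculus c n) (logic m hm) ↔ ¬ (c.eval [n]).Dom := by
  constructor
  · intro h hd
    simpa [Formula.mk, ValuedLogic.eval, logic] using h (bot_mem_thm hd) fun _ => ⟨0, by omega⟩
  · intro hd F hF v
    have hholds := holds_of_mem_thm hF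
    rcases F with i | ⟨j, args⟩
    -- A variable is not a theorem, since it does not hold under every assignment.
    · exact (hholds fun _ => { holds := False }).elim
    · by_cases hj : j = (0 : Fin 13)
      · subst hj
        exact (hd (hholds fun _ => {})).elim
      · simp [ValuedLogic.eval, logic, hj]

/-- The instance of the decision problem that asks whether `c` diverges on `[n]`. -/
def input (c : Code) (m : ℕ) (hm : 2 ≤ m) (n : ℕ) : Input m := ⟨evalLang, calculus c n, logic m hm⟩

/-- The input occurs in the word that presents the instance only as one unary numeral. -/
theorem exists_code_input (c : Code) (m : ℕ) (hm : 2 ≤ m) :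
    ∃ s t : List ℕ, ∀ n, (input c m hm n).code = s ++ (List.replicate n 7 ++ t) := by
  -- The rule for `bot` stands first: it has `1` premise, in which `3`, `11`, `7`, `5` and `9` are
  -- the symbols of the judgement, of list adjunction, of successor, of zero and of the empty list,
  -- and `0` is the variable; its conclusion is the symbol `1` of `bot`.
  refine ⟨m :: (evalLang.code ++ (codeList Formula.code axs ++
      (rules.length + 1) :: 1 :: 3 :: ((prog c).code ++ [11]))),
    5 :: 9 :: 0 :: 1 :: ((rules.map Rule.code).flatten ++ (logic m hm).code), fun n => ?_⟩
  simp [Input.code, input, Calculus.code, calculus, codeList, Rule.code, haltRule,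
    Formula.code_mk, code_num, Formula.code]

theorem computable_code_input (c : Code) (m : ℕ) (hm : 2 ≤ m) :
    Computable fun n => (input c m hm n).code := by
  obtain ⟨s, t, h⟩ := exists_code_input c m hm
  have hrep : Primrec fun n : ℕ => List.replicate n 7 :=
    (Primrec.nat_rec₁ (f := fun _ l => 7 :: l) [] 
      (Primrec.list_cons.comp (Primrec.const 7) Primrec.snd)).of_eq fun n => by
        induction n with
        | zero => rfl
        | succ n ih => simp only [ih, List.replicate_succ]
  exact (Primrec.list_append.comp (.const s)
    (Primrec.list_append.comp hrep (.const t))).to_comp.of_eq fun n => (h n).symm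

/-- One fixed program halts on the index of a partial recursive function if and only if that
function is defined at `0`. -/
theorem exists_universal : ∃ c : Code, ∀ a : Nat.Partrec.Code,
    (c.eval [Encodable.encode a]).Dom ↔ (a.eval 0).Dom := by
  have hf : Partrec fun n : ℕ => (Denumerable.ofNat Nat.Partrec.Code n).eval 0 :=
    Nat.Partrec.Code.eval_part.comp (Computable.ofNat _) (Computable.const 0)
  obtain ⟨c, hc⟩ := Code.exists_code (Nat.Partrec'.part_iff₁.2 hf)
  refine ⟨c, fun a => ?_⟩
  rw [show c.eval [Encodable.encode a] = _ from hc (Encodable.encode a ::ᵥ List.Vector.nil)]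
  simp

end evalLang

theorem not_algDecidable_weaklySound {m : ℕ} (hm : 2 ≤ m) :
    ¬ AlgDecidable (fun I : Input m => I.code) fun I => WeaklySound I.calculus I.logic := by
  rintro ⟨f, hf, h⟩
  obtain ⟨c, hc⟩ := evalLang.exists_universal
  let I (a : Nat.Partrec.Code) : Input m := evalLang.input c m hm (Encodable.encode a)
  choose b hb hbI using fun a => h (I a)
  have hcomp : Computable b :=
    (hf.comp ((evalLang.computable_code_input c m hm).comp Computable.encode)).of_eq
      fun a => Part.eq_some_iff.2 (hb a)
  refine ComputablePred.halting_problem 0 (ComputablePred.computable_iff.2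
    ⟨fun a => !b a, Primrec.not.to_comp.comp hcomp, funext fun a => propext ?_⟩)
  have : b a = true ↔ ¬ (a.eval 0).Dom :=
    (hbI a).trans ((evalLang.weaklySound_iff c _ m hm).trans (not_congr (hc a)))
  cases hba : b a <;> simp_all

end PropLogic

theorem mainTheorem6 :
    (¬ PropLogic.AlgDecidable (fun I : Σ m : ℕ, PropLogic.Input m => I.2.code)
        (fun I => PropLogic.WeaklySound I.2.calculus I.2.logic)) ∧
    (∀ m : ℕ, 2 ≤ m →
      ¬ PropLogic.AlgDecidable (fun I : PropLogic.Input m => I.code)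
        (fun I => PropLogic.WeaklySound I.calculus I.logic)) := by
  refine ⟨?_, fun m hm => PropLogic.not_algDecidable_weaklySound hm⟩
  rintro ⟨f, hf, h⟩
  exact PropLogic.not_algDecidable_weaklySound le_rfl ⟨f, hf, fun I => h ⟨2, I⟩⟩
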